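/- **Theorem (Comparison Principle).** Let $n\ge 1$ and let $\Omega\subset\mathbb{R}^n$ be a bounded domain (a non-empty, open, connected, bounded set). For a $C^2$ function $\phi$ write $$\Delta_\infty\phi=\sum_{i,j=1}^n\frac{\partial\phi}{\partial x_i}\frac{\partial\phi}{\partial x_j}\frac{\partial^2\phi}{\partial x_i\partial x_j}.$$ Let $u,v:\Omega\to\mathbb{R}$ be continuous functions such that $\Delta_\infty u\ge 0$ and $\Delta_\infty v\le 0$ in $\Omega$ in the viscosity sense, that is: * if $x_0\in\Omega$, $\psi\in C^2(\Omega)$, $u(x_0)=\psi(x_0)$ and $u(x)<\psi(x)$ for all $x\in\Omega\setminus\{x_0\}$, then $\Delta_\infty\psi(x_0)\ge 0$; * if $x_0\in\Omega$, $\phi\in C^2(\Omega)$, $v(x_0)=\phi(x_0)$ and $v(x)>\phi(x)$ for all $x\in\Omega\setminus\{x_0\}$, then $\Delta_\infty\phi(x_0)\le 0$. Suppose that, for every $\xi\in\partial\Omega$, $$\liminf_{\Omega\ni x\to\xi}v(x)\ \ge\ \limsup_{\Omega\ni x\to\xi}u(x)$$ as extended real numbers, and that the two sides are not both $+\infty$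 and not both $-\infty$. Then $v\ge u$ in $\Omega$. -/

import Mathlib

open Filter Topology

/-- The partial derivative `∂f/∂x_i` of a function on `ℝⁿ`. -/
noncomputable def partialDeriv {n : ℕ} (i : Fin n) (f : EuclideanSpace ℝ (Fin n) → ℝ)
    (x : EuclideanSpace ℝ (Fin n)) : ℝ :=
  fderiv ℝ f x (EuclideanSpace.single i (1 : ℝ))

/-- The infinity Laplacian
`Δ_∞ f = ∑ i j, (∂f/∂x_i) (∂f/∂x_j) (∂²f/∂x_i∂x_j)`. -/
noncomputable def infinityLaplacian {n : ℕ} (f : EuclideanSpace ℝ (Fin n) → ℝ)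
    (x : EuclideanSpace ℝ (Fin n)) : ℝ :=
  ∑ i : Fin n, ∑ j : Fin n,
    partialDeriv i f x * partialDeriv j f x * partialDeriv i (partialDeriv j f) x

/-- `φ` touches `v` (strictly) from below at the point `x₀`, within `Ω`. -/
def TouchesFromBelow {n : ℕ} (Ω : Set (EuclideanSpace ℝ (Fin n)))
    (φ v : EuclideanSpace ℝ (Fin n) → ℝ) (x₀ : EuclideanSpace ℝ (Fin n)) : Prop :=
  v x₀ = φ x₀ ∧ ∀ x ∈ Ω, x ≠ x₀ → φ x < v x

/-- `ψ` touches `u` (strictly) from above at the point `x₀`, within `Ω`. -/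
def TouchesFromAbove {n : ℕ} (Ω : Set (EuclideanSpace ℝ (Fin n)))
    (ψ u : EuclideanSpace ℝ (Fin n) → ℝ) (x₀ : EuclideanSpace ℝ (Fin n)) : Prop :=
  u x₀ = ψ x₀ ∧ ∀ x ∈ Ω, x ≠ x₀ → u x < ψ x

/-- `v ∈ C(Ω)` is a viscosity supersolution: `Δ_∞ v ≤ 0` in `Ω` in the viscosity sense. -/
def IsViscositySupersolution {n : ℕ} (Ω : Set (EuclideanSpace ℝ (Fin n)))
    (v : EuclideanSpace ℝ (Fin n) → ℝ) : Prop :=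
  ContinuousOn v Ω ∧
    ∀ x₀ ∈ Ω, ∀ φ : EuclideanSpace ℝ (Fin n) → ℝ,
      ContDiffOn ℝ 2 φ Ω → TouchesFromBelow Ω φ v x₀ → infinityLaplacian φ x₀ ≤ 0

/-- `u ∈ C(Ω)` is a viscosity subsolution: `Δ_∞ u ≥ 0` in `Ω` in the viscosity sense. -/
def IsViscositySubsolution {n : ℕ} (Ω : Set (EuclideanSpace ℝ (Fin n)))
    (u : EuclideanSpace ℝ (Fin n) → ℝ) : Prop :=
  ContinuousOn u Ω ∧
    ∀ x₀ ∈ Ω, ∀ ψ : EuclideanSpace ℝ (Fin n) → ℝ,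
      ContDiffOn ℝ 2 ψ Ω → TouchesFromAbove Ω ψ u x₀ → 0 ≤ infinityLaplacian ψ x₀

/-- The upper limit `limsup_{x → ξ, x ∈ Ω} u(x)`, as an extended real number. -/
noncomputable def upperBoundaryLimit {n : ℕ} (Ω : Set (EuclideanSpace ℝ (Fin n)))
    (u : EuclideanSpace ℝ (Fin n) → ℝ) (ξ : EuclideanSpace ℝ (Fin n)) : EReal :=
  limsup (fun x => (u x : EReal)) (𝓝[Ω] ξ)

/-- The lower limit `liminf_{x → ξ, x ∈ Ω} v(x)`, as an extended real number. -/
noncomputable def lowerBoundaryLimit {n : ℕ} (Ω : Set (EuclideanSpace ℝ (Fin n)))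
    (v : EuclideanSpace ℝ (Fin n) → ℝ) (ξ : EuclideanSpace ℝ (Fin n)) : EReal :=
  liminf (fun x => (v x : EReal)) (𝓝[Ω] ξ)

/-! Suppose `u p - v p = δ > 0`. Since `-v` is a subsolution as well, the task is to exclude an
interior maximum of the sum of two subsolutions; discretisation avoids any second-order theory for
such sums.

A subsolution lies below cones (`IsViscositySubsolution.le_cone`): otherwise a slightly concave bent
cone would touch it from above. On balls of radius `2 * ε` this implies that the supremum over
`ε`-balls, `ballSup`, satisfies a discrete inequality: twice its value at `x` is at most its maximum
plus its minimum over the `ε`-ball around `x`. For that inequality, comparison is an elementary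
extremal argument (`not_interior_max_of_finiteDifference`).

The boundary condition makes `{δ / 2 ≤ u - v}` compact in `Ω`, and uniform continuity keeps the
positive gap when `ε` is small. -/

/-! ### Calculus of the infinity Laplacian -/

/-- If `f` has gradient field `G` near `x` and `G` has derivative `H` at `x`, then
`Δ_∞ f x = ⟪G x, H (G x)⟫`. -/
theorem infinityLaplacian_eq_inner {n : ℕ} {f : EuclideanSpace ℝ (Fin n) → ℝ}
    {G : EuclideanSpace ℝ (Fin n) → EuclideanSpace ℝ (Fin n)} {x : EuclideanSpace ℝ (Fin n)}
    {H : EuclideanSpace ℝ (Fin n) →L[ℝ] EuclideanSpace ℝ (Fin n)}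
    (hf : ∀ᶠ y in 𝓝 x, HasFDerivAt f (innerSL ℝ (G y)) y) (hG : HasFDerivAt G H x) :
    infinityLaplacian f x = inner ℝ (G x) (H (G x)) := by
  have h1 : ∀ j, partialDeriv j f =ᶠ[𝓝 x] fun y => G y j := fun j => by
    filter_upwards [hf] with y hy
    simp [partialDeriv, hy.fderiv, EuclideanSpace.inner_single_right]
  have h2 : ∀ i j, partialDeriv i (partialDeriv j f) x = H (EuclideanSpace.single i 1) j := by
    intro i j
    have h3 : HasFDerivAt (fun y => G y j) ((EuclideanSpace.proj j).comp H) x :=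
      (EuclideanSpace.proj (𝕜 := ℝ) j).hasFDerivAt.comp x hG
    rw [partialDeriv, (h1 j).fderiv_eq, h3.fderiv]
    rfl
  have h4 : H (G x) = ∑ i, G x i • H (EuclideanSpace.single i 1) := by
    conv_lhs => rw [← (EuclideanSpace.basisFun (Fin n) ℝ).sum_repr (G x)]
    simp [map_sum]
  rw [h4, inner_sum]
  refine Finset.sum_congr rfl fun i _ => ?_
  rw [real_inner_smul_right, PiLp.inner_apply, Finset.mul_sum]
  refine Finset.sum_congr rfl fun j _ => ?_
  rw [(h1 i).self_of_nhds, (h1 j).self_of_nhds, h2]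
  simp
  ring

theorem infinityLaplacian_neg {n : ℕ} (f : EuclideanSpace ℝ (Fin n) → ℝ)
    (x : EuclideanSpace ℝ (Fin n)) :
    infinityLaplacian (fun y => -f y) x = -infinityLaplacian f x := by
  have h : ∀ (i : Fin n) (g : EuclideanSpace ℝ (Fin n) → ℝ),
      partialDeriv i (fun y => -g y) = fun y => -partialDeriv i g y := fun i g => by
    ext y
    simp [partialDeriv, fderiv_fun_neg]
  simp [infinityLaplacian, h, Finset.sum_neg_distrib]

theorem IsViscositySupersolution.neg {n : ℕ} {Ω : Set (EuclideanSpace ℝ (Fin n))}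
    {v : EuclideanSpace ℝ (Fin n) → ℝ} (hv : IsViscositySupersolution Ω v) :
    IsViscositySubsolution Ω (fun x => -v x) := by
  refine ⟨hv.1.neg, fun x₀ hx₀ ψ hψ ht => ?_⟩
  have := hv.2 x₀ hx₀ (fun x => -ψ x) hψ.neg
    ⟨by linarith [ht.1], fun x hx hne => by linarith [ht.2 x hx hne]⟩
  rw [infinityLaplacian_neg] at this
  linarith

theorem infinityLaplacian_congr {n : ℕ} {f g : EuclideanSpace ℝ (Fin n) → ℝ}
    {x : EuclideanSpace ℝ (Fin n)} (h : f =ᶠ[𝓝 x] g) :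
    infinityLaplacian f x = infinityLaplacian g x := by
  have h1 : ∀ j : Fin n, partialDeriv j f =ᶠ[𝓝 x] partialDeriv j g := fun j => by
    filter_upwards [h.eventuallyEq_nhds] with y hy
    rw [partialDeriv, partialDeriv, hy.fderiv_eq]
  have h2 : ∀ i j : Fin n,
      partialDeriv i (partialDeriv j f) x = partialDeriv i (partialDeriv j g) x := fun i j => by
    rw [partialDeriv, (h1 j).fderiv_eq, partialDeriv]
  simp only [infinityLaplacian, h2, (h1 _).self_of_nhds]

/-! ### Localisation of test functions -/

open scoped Manifold ContDiff in
/-- A function that is `C²` near `x₀` and lies strictly above `u` near `x₀` except at `x₀` itself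
can be changed away from `x₀` to a `C²` function on `Ω` that lies strictly above `u`. -/
theorem exists_contDiffOn_touchesFromAbove {n : ℕ} {Ω : Set (EuclideanSpace ℝ (Fin n))}
    (hΩ : IsOpen Ω) {u φ : EuclideanSpace ℝ (Fin n) → ℝ} (hu : ContinuousOn u Ω)
    {x₀ : EuclideanSpace ℝ (Fin n)} (hx₀ : x₀ ∈ Ω) (hφ : ContDiffAt ℝ 2 φ x₀)
    (heq : u x₀ = φ x₀) (hlt : ∀ᶠ x in 𝓝 x₀, x ≠ x₀ → u x < φ x) :
    ∃ ψ : EuclideanSpace ℝ (Fin n) → ℝ, ContDiffOn ℝ 2 ψ Ω ∧ TouchesFromAbove Ω ψ u x₀ ∧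
      ψ =ᶠ[𝓝 x₀] φ := by
  classical
  have h2 : ∀ᶠ x in 𝓝 x₀, ContDiffAt ℝ 2 φ x := hφ.eventually (by simp)
  obtain ⟨r, hr, hball⟩ := Metric.eventually_nhds_iff_ball.1 (h2.and hlt)
  let M : TopologicalSpace.Opens (EuclideanSpace ℝ (Fin n)) := ⟨Ω, hΩ⟩
  -- The constraints on `ψ` are convex at each point, so a partition of unity glues local solutions:
  -- `φ` near `x₀`, the constant `u y + 1` elsewhere. The singleton forces `ψ = φ` on the small
  -- ball.
  let t : M → Set ℝ := fun y =>
    if (y : EuclideanSpace ℝ (Fin n)) ∈ Metric.closedBall x₀ (r / 2) then {φ y} else Set.Ioi (u y)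
  have ht : ∀ y, Convex ℝ (t y) := fun y => by
    dsimp only [t]; split_ifs
    · exact convex_singleton _
    · exact convex_Ioi _
  have : SigmaCompactSpace M := by
    have : LocallyCompactSpace M := hΩ.locallyCompactSpace
    infer_instance
  obtain ⟨g, hg⟩ := exists_contMDiffMap_forall_mem_convex_of_local
    (n := 2) 𝓘(ℝ, EuclideanSpace ℝ (Fin n)) ht (by
    intro y
    by_cases hy : (y : EuclideanSpace ℝ (Fin n)) ∈ Metric.ball x₀ r
    · refine ⟨Subtype.val ⁻¹' Metric.ball x₀ r,
        (Metric.isOpen_ball.preimage continuous_subtype_val).mem_nhds hy, fun z => φ z, ?_, ?_⟩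
      · intro z hz
        exact ((contMDiffAt_subtype_iff (f := φ)).2
          (hball z hz).1.contMDiffAt).contMDiffWithinAt
      · intro z hz
        dsimp only [t]; split_ifs with h
        · rfl
        · refine (hball z hz).2 ?_
          rintro h'
          exact h (by rw [h']; exact Metric.mem_closedBall_self (by linarith))
    · have hc : ContinuousAt (fun z : M => u z) y :=
        (hu.continuousAt (hΩ.mem_nhds y.2)).comp continuous_subtype_val.continuousAt
      have h3 : ∀ᶠ z : M in 𝓝 y, u z < u y + 1 := hc.eventually_lt continuousAt_const (by linarith)
      have h4 : ∀ᶠ z : M in 𝓝 y, (z : EuclideanSpace ℝ (Fin n)) ∈ (Metric.closedBall x₀ (r / 2))ᶜ :=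
        (Metric.isClosed_closedBall.isOpen_compl.preimage continuous_subtype_val).mem_nhds
          fun h => hy (Metric.closedBall_subset_ball (by linarith) h)
      refine ⟨_, h3.and h4, fun _ => u y + 1, contMDiffOn_const, ?_⟩
      rintro z ⟨hz1, hz2⟩
      dsimp only [t]
      rw [if_neg hz2]
      exact hz1)
  let ψ : EuclideanSpace ℝ (Fin n) → ℝ := fun y => if h : y ∈ Ω then g ⟨y, h⟩ else 0
  have hψg : (fun y : M => ψ y) = g := by
    ext y
    exact dif_pos y.2
  have hψt : ∀ y : M, ψ y ∈ t y := fun y => by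
    rw [show ψ y = g y from congrFun hψg y]
    exact hg y
  have hψin : ∀ y ∈ Ω, y ∈ Metric.closedBall x₀ (r / 2) → ψ y = φ y := fun y hy h => by
    have := hψt ⟨y, hy⟩
    dsimp only [t] at this
    rwa [if_pos h] at this
  refine ⟨ψ, fun y hy => ?_, ⟨?_, fun y hy hne => ?_⟩, ?_⟩
  · have h5 : ContMDiffAt 𝓘(ℝ, EuclideanSpace ℝ (Fin n)) 𝓘(ℝ, ℝ) 2 (fun z : M => ψ z) ⟨y, hy⟩ := by
      rw [hψg]; exact g.contMDiff.contMDiffAt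
    exact (contMDiffAt_subtype_iff.1 h5).contDiffAt.contDiffWithinAt
  · rw [hψin x₀ hx₀ (Metric.mem_closedBall_self (by linarith)), heq]
  · by_cases h : y ∈ Metric.closedBall x₀ (r / 2)
    · rw [hψin y hy h]
      exact (hball y (Metric.closedBall_subset_ball (by linarith) h)).2 hne
    · have := hψt ⟨y, hy⟩
      dsimp only [t] at this
      rwa [if_neg h] at this
  · filter_upwards [hΩ.mem_nhds hx₀, Metric.closedBall_mem_nhds x₀ (half_pos hr)] with y hy h
    exact hψin y hy h

theorem IsViscositySubsolution.infinityLaplacian_nonneg {n : ℕ}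
    {Ω : Set (EuclideanSpace ℝ (Fin n))} (hΩ : IsOpen Ω) {u φ : EuclideanSpace ℝ (Fin n) → ℝ}
    (hu : IsViscositySubsolution Ω u) {x₀ : EuclideanSpace ℝ (Fin n)} (hx₀ : x₀ ∈ Ω)
    (hφ : ContDiffAt ℝ 2 φ x₀) (heq : u x₀ = φ x₀) (hlt : ∀ᶠ x in 𝓝 x₀, x ≠ x₀ → u x < φ x) :
    0 ≤ infinityLaplacian φ x₀ := by
  obtain ⟨ψ, h1, h2, h3⟩ := exists_contDiffOn_touchesFromAbove hΩ hu.1 hx₀ hφ heq hlt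
  rw [← infinityLaplacian_congr h3]
  exact hu.2 x₀ hx₀ ψ h1 h2

/-! ### Discrete comparison and suprema over balls -/

/-- Two continuous functions that satisfy the finite-difference inequality on `K` cannot have the
maximum of their sum over the `ε`-neighbourhood of `K` strictly inside. -/
theorem not_interior_max_of_finiteDifference {n : ℕ} (i : Fin n)
    {K : Set (EuclideanSpace ℝ (Fin n))} (hK : IsCompact K) {ε : ℝ} (hε : 0 < ε)
    {f g : EuclideanSpace ℝ (Fin n) → ℝ} (hfc : Continuous f) (hgc : Continuous g)
    (hf : ∀ x ∈ K, ∃ y ∈ Metric.closedBall x ε, ∀ z ∈ Metric.closedBall x ε,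
      2 * f x ≤ f y + f z)
    (hg : ∀ x ∈ K, ∃ y ∈ Metric.closedBall x ε, ∀ z ∈ Metric.closedBall x ε,
      2 * g x ≤ g y + g z)
    {p : EuclideanSpace ℝ (Fin n)} (hp : p ∈ K)
    (hout : ∀ x ∈ K, ∀ y ∈ Metric.closedBall x ε, y ∉ K → f y + g y < f p + g p) : False := by
  have hsc : Continuous fun x => f x + g x := hfc.add hgc
  obtain ⟨a, haK, ha⟩ := hK.exists_isMaxOn ⟨p, hp⟩ hsc.continuousOn
  have hE : IsCompact (K ∩ {x | f x + g x = f a + g a}) :=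
    hK.inter_right (isClosed_eq hsc continuous_const)
  -- Ties are broken twice: among the maximisers of `f + g` by the value of `f`, then by the `i`-th
  -- coordinate.
  obtain ⟨b, hbE, hb⟩ := hE.exists_isMaxOn ⟨a, haK, rfl⟩ hfc.continuousOn
  have hF : IsCompact (K ∩ {x | f x + g x = f a + g a} ∩ {x | f x = f b}) :=
    hE.inter_right (isClosed_eq hfc continuous_const)
  obtain ⟨c, ⟨⟨hcK, hcE⟩, hcF⟩, hc⟩ := hF.exists_isMaxOn ⟨b, hbE, rfl⟩
    (f := fun x => x i) (by fun_prop)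
  simp only [Set.mem_ofPred_eq] at hcE hcF
  have hle : ∀ y ∈ Metric.closedBall c ε, f y + g y ≤ f c + g c := fun y hy => by
    by_cases h : y ∈ K
    · have := isMaxOn_iff.1 ha y h
      linarith
    · have h1 := hout c hcK y hy h
      have h2 := isMaxOn_iff.1 ha p hp
      linarith
  have hmem : ∀ y ∈ Metric.closedBall c ε, f y + g y = f c + g c → y ∈ K := fun y hy h => by
    by_contra h'
    have h1 := hout c hcK y hy h'
    have h2 := isMaxOn_iff.1 ha p hp
    linarith
  have hfle : ∀ y ∈ Metric.closedBall c ε, f y + g y = f c + g c → f y ≤ f c := fun y hy h => by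
    have := isMaxOn_iff.1 hb y ⟨hmem y hy h, by simp only [Set.mem_ofPred_eq]; linarith⟩
    linarith
  obtain ⟨yf, hyf, hf'⟩ := hf c hcK
  obtain ⟨yg, hyg, hg'⟩ := hg c hcK
  by_cases hz : ∃ z ∈ Metric.closedBall c ε, f c < f z
  · obtain ⟨z, hzm, hzc⟩ := hz
    obtain ⟨w, hw, hwmax⟩ := (isCompact_closedBall c ε).exists_isMaxOn ⟨z, hzm⟩ hfc.continuousOn
    have h1 := isMaxOn_iff.1 hwmax z hzm
    have h2 := isMaxOn_iff.1 hwmax yf hyf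
    -- Since `f w > f c`, the choice of `c` prevents `w` from maximising the sum. Adding the
    -- inequality for `f` at `yg` to that for `g` at `w` then gives a contradiction.
    have h3 : f w + g w < f c + g c := lt_of_le_of_ne (hle w hw) fun h => by
      linarith [hfle w hw h]
    have h4 := hf' yg hyg
    have h5 := hg' w hw
    have h6 := hle yg hyg
    linarith
  · push Not at hz
    have hfe : ∀ z ∈ Metric.closedBall c ε, f z = f c := fun z hzm => by
      linarith [hz z hzm, hf' z hzm, hz yf hyf]
    have hge : ∀ z ∈ Metric.closedBall c ε, g z = g c := fun z hzm => by
      linarith [hle z hzm, hg' z hzm, hle yg hyg, hfe z hzm, hfe yg hyg]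
    -- Both functions are constant on the ball, so this translate is an equally good maximiser with
    -- a larger `i`-th coordinate.
    have hq : c + EuclideanSpace.single i ε ∈ Metric.closedBall c ε := by
      simp [abs_of_pos hε]
    have hq1 : f (c + EuclideanSpace.single i ε) + g (c + EuclideanSpace.single i ε)
        = f c + g c := by rw [hfe _ hq, hge _ hq]
    have := isMaxOn_iff.1 hc (c + EuclideanSpace.single i ε)
      ⟨⟨hmem _ hq hq1, hq1.trans hcE⟩, (hfe _ hq).trans hcF⟩
    simp at this
    linarith

/-- The supremum of `u` over the closed ball of radius `ε` around the point. -/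
noncomputable def ballSup {n : ℕ} (u : EuclideanSpace ℝ (Fin n) → ℝ) (ε : ℝ)
    (x : EuclideanSpace ℝ (Fin n)) : ℝ :=
  sSup ((fun z => u (x + z)) '' Metric.closedBall 0 ε)

theorem continuous_ballSup {n : ℕ} {u : EuclideanSpace ℝ (Fin n) → ℝ} (hu : Continuous u)
    (ε : ℝ) : Continuous (ballSup u ε) :=
  (isCompact_closedBall (0 : EuclideanSpace ℝ (Fin n)) ε).continuous_sSup
    (f := fun x z => u (x + z)) (by fun_prop)

theorem le_ballSup {n : ℕ} {u : EuclideanSpace ℝ (Fin n) → ℝ} (hu : Continuous u) {ε : ℝ}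
    {x y : EuclideanSpace ℝ (Fin n)} (hy : y ∈ Metric.closedBall x ε) : u y ≤ ballSup u ε x := by
  refine le_csSup ((isCompact_closedBall (0 : EuclideanSpace ℝ (Fin n)) ε).image
    (f := fun z => u (x + z)) (by fun_prop)).bddAbove ⟨y - x, ?_, by simp⟩
  simpa [dist_eq_norm] using hy

theorem exists_ballSup_eq {n : ℕ} {u : EuclideanSpace ℝ (Fin n) → ℝ} (hu : Continuous u) {ε : ℝ}
    (hε : 0 ≤ ε) (x : EuclideanSpace ℝ (Fin n)) :
    ∃ y ∈ Metric.closedBall x ε, ballSup u ε x = u y := by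
  obtain ⟨z, hz, h⟩ := (isCompact_closedBall (0 : EuclideanSpace ℝ (Fin n)) ε).exists_sSup_image_eq
    ⟨0, Metric.mem_closedBall_self hε⟩ (f := fun z => u (x + z)) (by fun_prop)
  exact ⟨x + z, by simpa using hz, h⟩

/-- Comparison with cones on the ball of radius `2 ε` gives the finite-difference inequality for
the supremum over balls of radius `ε`. -/
theorem exists_two_mul_ballSup_le {n : ℕ} {u : EuclideanSpace ℝ (Fin n) → ℝ}
    (hu : Continuous u) {ε : ℝ} (hε : 0 < ε) {x : EuclideanSpace ℝ (Fin n)}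
    (hcone : ∀ M : ℝ, (∀ w ∈ Metric.closedBall x (2 * ε), u w ≤ M) →
      ∀ w ∈ Metric.closedBall x (2 * ε), u w ≤ u x + (M - u x) / (2 * ε) * dist w x) :
    ∃ y ∈ Metric.closedBall x ε, ∀ z ∈ Metric.closedBall x ε,
      2 * ballSup u ε x ≤ ballSup u ε y + ballSup u ε z := by
  have hx : x ∈ Metric.closedBall x (2 * ε) := Metric.mem_closedBall_self (by linarith)
  obtain ⟨w, hw, hmax⟩ := (isCompact_closedBall x (2 * ε)).exists_isMaxOn
    ⟨x, hx⟩ hu.continuousOn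
  have hw' : dist x w ≤ 2 * ε := by rw [dist_comm]; exact hw
  -- The midpoint is within `ε` of `w`, so its supremum is at least `u w`; every `z` sees `x`. At
  -- distance at most `ε`, the cone is bounded by the average of `u x` and `u w`.
  refine ⟨midpoint ℝ x w, ?_, fun z hz => ?_⟩
  · rw [Metric.mem_closedBall, dist_midpoint_left]
    norm_num
    linarith
  have h1 : u w ≤ ballSup u ε (midpoint ℝ x w) := by
    refine le_ballSup hu ?_
    rw [Metric.mem_closedBall, dist_right_midpoint]
    norm_num
    linarith
  have h2 : u x ≤ ballSup u ε z := le_ballSup hu (by rw [Metric.mem_closedBall, dist_comm]; exact hz)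
  obtain ⟨y, hy, hye⟩ := exists_ballSup_eq hu hε.le x
  have h3 := hcone (u w) (isMaxOn_iff.1 hmax) y
    (Metric.closedBall_subset_closedBall (by linarith) hy)
  have h4 : (u w - u x) / (2 * ε) * dist y x ≤ (u w - u x) / (2 * ε) * ε := by
    have := isMaxOn_iff.1 hmax x hx
    exact mul_le_mul_of_nonneg_left hy (div_nonneg (by linarith) (by linarith))
  have h5 : (u w - u x) / (2 * ε) * ε = (u w - u x) / 2 := by field_simp
  linarith

/-! ### Comparison with cones -/

theorem hasFDerivAt_norm_sub {E : Type*} [NormedAddCommGroup E] [InnerProductSpace ℝ E]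
    {x y : E} (h : y ≠ x) :
    HasFDerivAt (fun y => ‖y - x‖) (innerSL ℝ (‖y - x‖⁻¹ • (y - x))) y := by
  have h0 : ‖y - x‖ ≠ 0 := norm_ne_zero_iff.2 (sub_ne_zero.2 h)
  have h1 := (((hasFDerivAt_id (𝕜 := ℝ) y).sub_const x).norm_sq).sqrt (pow_ne_zero 2 h0)
  simp only [id, Real.sqrt_sq (norm_nonneg _)] at h1
  refine h1.congr_fderiv ?_
  ext v
  simp
  field_simp

theorem hasFDerivAt_norm_sub_sq {E : Type*} [NormedAddCommGroup E] [InnerProductSpace ℝ E]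
    (x y : E) : HasFDerivAt (fun y => ‖y - x‖ ^ 2) (innerSL ℝ ((2 : ℝ) • (y - x))) y := by
  refine ((hasFDerivAt_id (𝕜 := ℝ) y).sub_const x).norm_sq.congr_fderiv ?_
  ext v
  simp

/-- The infinity Laplacian of a cone bent by a quadratic; the quartic term does not contribute. -/
theorem infinityLaplacian_bentCone {n : ℕ} {x y₀ : EuclideanSpace ℝ (Fin n)} (h : y₀ ≠ x)
    (a b γ : ℝ) :
    infinityLaplacian (fun y => a + b * ‖y - x‖ - γ * ‖y - x‖ ^ 2 + (‖y - y₀‖ ^ 2) ^ 2) y₀ =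
      -2 * γ * ‖y₀ - x‖ ^ 2 * (b * ‖y₀ - x‖⁻¹ - 2 * γ) ^ 2 := by
  have h0 : ‖y₀ - x‖ ≠ 0 := norm_ne_zero_iff.2 (sub_ne_zero.2 h)
  have hgrad : ∀ᶠ y in 𝓝 y₀, HasFDerivAt
      (fun y => a + b * ‖y - x‖ - γ * ‖y - x‖ ^ 2 + (‖y - y₀‖ ^ 2) ^ 2)
      (innerSL ℝ ((b * ‖y - x‖⁻¹ - 2 * γ) • (y - x) + (4 * ‖y - y₀‖ ^ 2) • (y - y₀))) y := by
    filter_upwards [isOpen_ne.mem_nhds h] with y hy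
    refine ((((hasFDerivAt_norm_sub hy).const_mul b).const_add a).sub
      ((hasFDerivAt_norm_sub_sq x y).const_mul γ)).add
      ((hasFDerivAt_norm_sub_sq y₀ y).pow 2) |>.congr_fderiv ?_
    ext v
    simp
    ring
  have hinv : HasFDerivAt (fun y => b * ‖y - x‖⁻¹ - 2 * γ)
      (b • (-(‖y₀ - x‖ ^ 2)⁻¹) • innerSL ℝ (‖y₀ - x‖⁻¹ • (y₀ - x))) y₀ :=
    (((hasDerivAt_inv h0).comp_hasFDerivAt y₀ (hasFDerivAt_norm_sub h)).const_mul b).sub_const _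
  have hhess := (hinv.smul ((hasFDerivAt_id (𝕜 := ℝ) y₀).sub_const x)).add
    (((hasFDerivAt_norm_sub_sq y₀ y₀).const_mul 4).smul
      ((hasFDerivAt_id (𝕜 := ℝ) y₀).sub_const y₀))
  rw [infinityLaplacian_eq_inner hgrad hhess]
  simp only [id]
  generalize y₀ - x = d at h0 ⊢
  simp [inner_add_right, real_inner_smul_left, real_inner_smul_right, norm_smul, mul_pow]
  field_simp
  ring

theorem contDiffAt_bentCone {n : ℕ} {x y₀ : EuclideanSpace ℝ (Fin n)} (h : y₀ ≠ x)
    (a b γ : ℝ) :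
    ContDiffAt ℝ 2
      (fun y => a + b * ‖y - x‖ - γ * ‖y - x‖ ^ 2 + (‖y - y₀‖ ^ 2) ^ 2) y₀ := by
  have h1 : ContDiffAt ℝ 2 (fun y => ‖y - x‖) y₀ :=
    (contDiffAt_id.sub contDiffAt_const).norm ℝ (sub_ne_zero.2 h)
  have h2 : ContDiffAt ℝ 2 (fun y => ‖y - y₀‖ ^ 2) y₀ :=
    (contDiffAt_id.sub contDiffAt_const).norm_sq ℝ
  exact ((contDiffAt_const.add (contDiffAt_const.mul h1)).sub
    (contDiffAt_const.mul (h1.pow 2))).add (h2.pow 2)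

/-- Viscosity subsolutions enjoy comparison with cones from above. -/
theorem IsViscositySubsolution.le_cone {n : ℕ} {Ω : Set (EuclideanSpace ℝ (Fin n))}
    (hΩ : IsOpen Ω) {u : EuclideanSpace ℝ (Fin n) → ℝ} (hu : IsViscositySubsolution Ω u)
    {x : EuclideanSpace ℝ (Fin n)} {R : ℝ} (hR : 0 < R) (hball : Metric.closedBall x R ⊆ Ω)
    {M : ℝ} (hM : ∀ w ∈ Metric.closedBall x R, u w ≤ M) {w : EuclideanSpace ℝ (Fin n)}
    (hw : w ∈ Metric.closedBall x R) : u w ≤ u x + (M - u x) / R * dist w x := by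
  by_contra! hcon
  have hxM : u x ≤ M := hM x (Metric.mem_closedBall_self hR.le)
  rw [Metric.mem_closedBall, dist_eq_norm] at hw
  rw [dist_eq_norm] at hcon
  set b₀ := (M - u x) / R with hb₀
  have hb₀0 : 0 ≤ b₀ := div_nonneg (by linarith) hR.le
  have hb₀R : b₀ * R = M - u x := by rw [hb₀]; field_simp
  obtain ⟨η, hη⟩ : ∃ η, η = u w - u x - b₀ * ‖w - x‖ := ⟨_, rfl⟩
  have hη0 : 0 < η := by linarith
  -- Raising the slope by `e` costs at most `η / 2` of the excess `η`, and moves the maximum off the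
  -- sphere. With `γ = e / (4 * R)` the bending gives back only a quarter of `e * R` there and keeps
  -- the radial slope positive.
  obtain ⟨e, he⟩ : ∃ e, e = η / (2 * R) := ⟨_, rfl⟩
  have he0 : 0 < e := by rw [he]; positivity
  have heR : e * R = η / 2 := by rw [he]; field_simp
  obtain ⟨γ, hγ⟩ : ∃ γ, γ = e / (4 * R) := ⟨_, rfl⟩
  have hγ0 : 0 < γ := by rw [hγ]; positivity
  have hγR : γ * R = e / 4 := by rw [hγ]; field_simp
  have hcont : ContinuousOn (fun y => u y - (b₀ + e) * ‖y - x‖ + γ * ‖y - x‖ ^ 2)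
      (Metric.closedBall x R) :=
    ((hu.1.mono hball).sub (by fun_prop)).add (by fun_prop)
  obtain ⟨y₀, hy₀, hmax⟩ := (isCompact_closedBall x R).exists_isMaxOn
    ⟨x, Metric.mem_closedBall_self hR.le⟩ hcont
  have hw1 := isMaxOn_iff.1 hmax w (by rwa [Metric.mem_closedBall, dist_eq_norm])
  have hgt : u x < u y₀ - (b₀ + e) * ‖y₀ - x‖ + γ * ‖y₀ - x‖ ^ 2 := by
    have h1 : e * ‖w - x‖ ≤ e * R := mul_le_mul_of_nonneg_left hw he0.le
    have h2 : 0 ≤ γ * ‖w - x‖ ^ 2 := by positivity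
    linarith
  have hne : y₀ ≠ x := by
    rintro rfl
    simp at hgt
  have hlt : ‖y₀ - x‖ < R := by
    refine lt_of_le_of_ne (by rwa [Metric.mem_closedBall, dist_eq_norm] at hy₀) fun h => ?_
    rw [h] at hgt
    have h1 := hM y₀ hy₀
    have h2 : γ * R ^ 2 = e * R / 4 := by rw [pow_two, ← mul_assoc, hγR]; ring
    linarith
  have hpos : 0 < ‖y₀ - x‖ := norm_pos_iff.2 (sub_ne_zero.2 hne)
  -- The quartic term makes the touching at `y₀` strict.
  have hnn := hu.infinityLaplacian_nonneg hΩ (hball hy₀)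
    (contDiffAt_bentCone hne (u y₀ - (b₀ + e) * ‖y₀ - x‖ + γ * ‖y₀ - x‖ ^ 2) (b₀ + e) γ)
    (by simp; ring) (by
      filter_upwards [Metric.isOpen_ball.mem_nhds
        (show y₀ ∈ Metric.ball x R by rwa [Metric.mem_ball, dist_eq_norm])] with y hy hyne
      have h1 := isMaxOn_iff.1 hmax y (Metric.ball_subset_closedBall hy)
      have h2 : 0 < ‖y - y₀‖ := norm_pos_iff.2 (sub_ne_zero.2 hyne)
      have h3 : 0 < (‖y - y₀‖ ^ 2) ^ 2 := by positivity
      linarith)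
  rw [infinityLaplacian_bentCone hne] at hnn
  have hk : 0 < (b₀ + e) * ‖y₀ - x‖⁻¹ - 2 * γ := by
    rw [← div_eq_mul_inv, sub_pos, lt_div_iff₀ hpos]
    have : γ * ‖y₀ - x‖ ≤ γ * R := mul_le_mul_of_nonneg_left hlt.le hγ0.le
    linarith
  have : 0 < γ * ‖y₀ - x‖ ^ 2 * ((b₀ + e) * ‖y₀ - x‖⁻¹ - 2 * γ) ^ 2 := by positivity
  linarith

/-! ### Boundary limits and compactness -/

/-- If `a ≤ b` in `EReal` and they are not equal to the same infinity, then a real number lies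
between them up to an error `δ`. -/
theorem EReal.exists_real_lt_add_of_le {a b : EReal} (h : a ≤ b) (htop : ¬(a = ⊤ ∧ b = ⊤))
    (hbot : ¬(a = ⊥ ∧ b = ⊥)) {δ : ℝ} (hδ : 0 < δ) :
    ∃ c : ℝ, a < ((c + δ : ℝ) : EReal) ∧ ((c - δ : ℝ) : EReal) < b := by
  induction a with
  | top => exact absurd ⟨rfl, top_le_iff.1 h⟩ htop
  | bot =>
    induction b with
    | bot => exact absurd ⟨rfl, rfl⟩ hbot
    | top => exact ⟨0, EReal.bot_lt_coe _, EReal.coe_lt_top _⟩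
    | coe b => exact ⟨b, EReal.bot_lt_coe _, EReal.coe_lt_coe_iff.2 (by linarith)⟩
  | coe a =>
    refine ⟨a, EReal.coe_lt_coe_iff.2 (by linarith), lt_of_lt_of_le ?_ h⟩
    exact EReal.coe_lt_coe_iff.2 (by linarith)

theorem eventually_sub_lt_of_boundaryLimit_le {n : ℕ} {Ω : Set (EuclideanSpace ℝ (Fin n))}
    {u v : EuclideanSpace ℝ (Fin n) → ℝ} {ξ : EuclideanSpace ℝ (Fin n)}
    (h : upperBoundaryLimit Ω u ξ ≤ lowerBoundaryLimit Ω v ξ)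
    (htop : ¬(upperBoundaryLimit Ω u ξ = ⊤ ∧ lowerBoundaryLimit Ω v ξ = ⊤))
    (hbot : ¬(upperBoundaryLimit Ω u ξ = ⊥ ∧ lowerBoundaryLimit Ω v ξ = ⊥))
    {δ : ℝ} (hδ : 0 < δ) : ∀ᶠ x in 𝓝[Ω] ξ, u x - v x < δ := by
  obtain ⟨c, hc1, hc2⟩ := EReal.exists_real_lt_add_of_le h htop hbot (half_pos hδ)
  filter_upwards [eventually_lt_of_limsup_lt hc1, eventually_lt_of_lt_liminf hc2] with x h1 h2
  have h1 := EReal.coe_lt_coe_iff.1 h1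
  have h2 := EReal.coe_lt_coe_iff.1 h2
  linarith

/-- Limit points in `Ω` are handled by continuity, and `hb` excludes those on the frontier, so the
set is closed in the whole space. -/
theorem isCompact_superlevel_sub {n : ℕ} {Ω : Set (EuclideanSpace ℝ (Fin n))}
    (hΩ : Bornology.IsBounded Ω) {u v : EuclideanSpace ℝ (Fin n) → ℝ}
    (hu : ContinuousOn u Ω) (hv : ContinuousOn v Ω) {δ : ℝ}
    (hb : ∀ ξ ∈ frontier Ω, ∀ᶠ x in 𝓝[Ω] ξ, u x - v x < δ) :
    IsCompact {x ∈ Ω | δ ≤ u x - v x} := by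
  refine Metric.isCompact_of_isClosed_isBounded ?_ (hΩ.subset fun x hx => hx.1)
  refine isClosed_of_closure_subset fun ξ hξ => ?_
  have hξΩ : ξ ∈ closure Ω := closure_mono (fun x hx => hx.1) hξ
  have hfreq : ∃ᶠ x in 𝓝[Ω] ξ, δ ≤ u x - v x := by
    rw [frequently_nhdsWithin_iff]
    exact (mem_closure_iff_frequently.1 hξ).mono fun x hx => ⟨hx.2, hx.1⟩
  by_cases hmem : ξ ∈ Ω
  · refine ⟨hmem, ?_⟩
    by_contra! hlt
    exact hfreq (((hu.sub hv) ξ hmem).eventually_lt continuousWithinAt_const hlt |>.mono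
      fun x hx => not_le.2 hx)
  · have hfr : ξ ∈ frontier Ω := ⟨hξΩ, fun h => hmem (interior_subset h)⟩
    exact absurd ((hb ξ hfr).mono fun x hx => not_le.2 hx) hfreq

/-- A function continuous on a compact set agrees there with a continuous function. -/
theorem IsCompact.exists_continuous_eqOn {X : Type*} [MetricSpace X] {C : Set X}
    (hC : IsCompact C) {u : X → ℝ} (hu : ContinuousOn u C) :
    ∃ w : X → ℝ, Continuous w ∧ ∀ x ∈ C, w x = u x := by
  obtain ⟨g, hg⟩ := ContinuousMap.exists_restrict_eq hC.isClosed ⟨C.domRestrict u, hu.domRestrict⟩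
  exact ⟨g, g.continuous, fun x hx => congrArg (fun f : C(C, ℝ) => f ⟨x, hx⟩) hg⟩

/-! ### Comparison for viscosity solutions -/

theorem exists_two_mul_ballSup_le_of_isViscositySubsolution {n : ℕ}
    {Ω : Set (EuclideanSpace ℝ (Fin n))} (hΩ : IsOpen Ω) {u w : EuclideanSpace ℝ (Fin n) → ℝ}
    (hu : IsViscositySubsolution Ω u) (hw : Continuous w) {ε : ℝ} (hε : 0 < ε)
    {x : EuclideanSpace ℝ (Fin n)} (hball : Metric.closedBall x (2 * ε) ⊆ Ω)
    (heq : ∀ y ∈ Metric.closedBall x (2 * ε), w y = u y) :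
    ∃ y ∈ Metric.closedBall x ε, ∀ z ∈ Metric.closedBall x ε,
      2 * ballSup w ε x ≤ ballSup w ε y + ballSup w ε z := by
  refine exists_two_mul_ballSup_le hw hε fun M hM z hz => ?_
  rw [heq z hz, heq x (Metric.mem_closedBall_self (by linarith))]
  exact hu.le_cone hΩ (by linarith) hball (fun y hy => heq y hy ▸ hM y hy) hz

theorem mainTheorem2 (n : ℕ) (hn : 1 ≤ n)
    (Ω : Set (EuclideanSpace ℝ (Fin n)))
    (hΩ_open : IsOpen Ω) (hΩ_conn : IsConnected Ω) (hΩ_bdd : Bornology.IsBounded Ω)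
    (u v : EuclideanSpace ℝ (Fin n) → ℝ)
    (hu : IsViscositySubsolution Ω u) (hv : IsViscositySupersolution Ω v)
    (hbdry : ∀ ξ ∈ frontier Ω, upperBoundaryLimit Ω u ξ ≤ lowerBoundaryLimit Ω v ξ)
    (htop : ∀ ξ ∈ frontier Ω, ¬ (upperBoundaryLimit Ω u ξ = ⊤ ∧ lowerBoundaryLimit Ω v ξ = ⊤))
    (hbot : ∀ ξ ∈ frontier Ω, ¬ (upperBoundaryLimit Ω u ξ = ⊥ ∧ lowerBoundaryLimit Ω v ξ = ⊥)) :
    ∀ x ∈ Ω, u x ≤ v x := by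
  intro p hp
  by_contra! hcon
  obtain ⟨δ, hδ⟩ : ∃ δ, δ = u p - v p := ⟨_, rfl⟩
  have hδ0 : 0 < δ := by linarith
  set K := {x ∈ Ω | δ / 2 ≤ u x - v x} with hKdef
  have hK : IsCompact K := isCompact_superlevel_sub hΩ_bdd hu.1 hv.1 fun ξ hξ =>
    eventually_sub_lt_of_boundaryLimit_le (hbdry ξ hξ) (htop ξ hξ) (hbot ξ hξ) (half_pos hδ0)
  have hpK : p ∈ K := ⟨hp, by linarith⟩
  obtain ⟨r, hr, hrΩ⟩ := hK.exists_cthickening_subset_open hΩ_open fun x hx => hx.1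
  have hC : IsCompact (Metric.cthickening r K) := hK.cthickening
  have hnv := hv.neg
  obtain ⟨U, hUc, hU⟩ := hC.exists_continuous_eqOn (hu.1.mono hrΩ)
  obtain ⟨V, hVc, hV⟩ := hC.exists_continuous_eqOn (hnv.1.mono hrΩ)
  -- Off `K` the sum `U + V` is below `δ / 2`; two errors of `δ / 8` leave the smoothed sum below
  -- `δ`, its lower bound at `p`.
  obtain ⟨d₁, hd₁, hUu⟩ := Metric.uniformContinuousOn_iff_le.1
    (hC.uniformContinuousOn_of_continuous hUc.continuousOn) (δ / 8) (by linarith)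
  obtain ⟨d₂, hd₂, hVu⟩ := Metric.uniformContinuousOn_iff_le.1
    (hC.uniformContinuousOn_of_continuous hVc.continuousOn) (δ / 8) (by linarith)
  obtain ⟨ε, hε, hεr, hε1, hε2⟩ : ∃ ε > 0, 2 * ε ≤ r ∧ ε ≤ d₁ ∧ ε ≤ d₂ :=
    ⟨min (r / 2) (min d₁ d₂), by positivity,
      by linarith [min_le_left (r / 2) (min d₁ d₂)],
      (min_le_right _ _).trans (min_le_left _ _), (min_le_right _ _).trans (min_le_right _ _)⟩
  have hsub : ∀ x ∈ K, Metric.closedBall x (2 * ε) ⊆ Metric.cthickening r K := fun x hx =>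
    (Metric.closedBall_subset_closedBall hεr).trans (Metric.closedBall_subset_cthickening hx r)
  refine not_interior_max_of_finiteDifference ⟨0, hn⟩ hK hε
    (continuous_ballSup hUc ε) (continuous_ballSup hVc ε)
    (fun x hx => exists_two_mul_ballSup_le_of_isViscositySubsolution hΩ_open hu hUc hε
      ((hsub x hx).trans hrΩ) fun y hy => hU y (hsub x hx hy))
    (fun x hx => exists_two_mul_ballSup_le_of_isViscositySubsolution hΩ_open hnv hVc hε
      ((hsub x hx).trans hrΩ) fun y hy => hV y (hsub x hx hy)) hpK ?_
  intro x hx y hy hyK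
  have hyball : Metric.closedBall y ε ⊆ Metric.cthickening r K := by
    refine (Metric.closedBall_subset_closedBall' ?_).trans (hsub x hx)
    linarith [Metric.mem_closedBall.1 hy]
  have hyC := hyball (Metric.mem_closedBall_self hε.le)
  obtain ⟨y₁, hy₁, h1⟩ := exists_ballSup_eq hUc hε.le y
  obtain ⟨y₂, hy₂, h2⟩ := exists_ballSup_eq hVc hε.le y
  have h3 := hUu y₁ (hyball hy₁) y hyC ((Metric.mem_closedBall.1 hy₁).trans hε1)
  have h4 := hVu y₂ (hyball hy₂) y hyC ((Metric.mem_closedBall.1 hy₂).trans hε2)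
  rw [Real.dist_eq] at h3 h4
  have h5 : u y - v y < δ / 2 := not_le.1 fun h => hyK ⟨hrΩ hyC, h⟩
  have h6 : U p ≤ ballSup U ε p := le_ballSup hUc (Metric.mem_closedBall_self hε.le)
  have h7 : V p ≤ ballSup V ε p := le_ballSup hVc (Metric.mem_closedBall_self hε.le)
  have hpC := hsub p hpK (Metric.mem_closedBall_self (by linarith))
  have h8 := hU p hpC
  have h9 := hV p hpC
  have h10 := hU y hyC
  have h11 := hV y hyC
  linarith [le_abs_self (U y₁ - U y), le_abs_self (V y₂ - V y)]
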